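/- For a positive integer $n$, let $\tau(n)$ be the number of its positive divisors and $\omega(n)$ the number of its distinct prime factors. For every positive integer $n$ with $k=\omega(n)\ge 74$, $$\tau(n)<\left(1+\frac{\log n}{k\log k}\right)^k.$$ The bound $74$ is best possible: if, for $k=\omega(n)\ge 2$, we set $$\lambda(n):=\frac{(\tau(n)^{1/k}-1)\,k\log k}{\log n},$$ so that $\tau(n)=\left(1+\frac{\lambda(n)\log n}{k\log k}\right)^k$, then the number $$n'=2^{13}\cdot3^8\cdot5^5\cdot7^4\cdot11^3\cdot13^3\cdot17^3\cdot19^2\cdots53^2\cdot59\cdots367,$$ whose prime factors are the first $73$ primes (each prime from $19$ to $53$ with exponent $2$, each prime from $59$ to $367$ with exponent $1$), satisfies $\omega(n')=73$ and $\lambda(n')>1$. -/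

import Mathlib

open ArithmeticFunction

/-- The number `τ(n)` of positive divisors of `n`. -/
def tau (n : ℕ) : ℕ := n.divisors.card

/-- `λ(n) = (τ(n)^{1/k} - 1) k log k / log n` with `k = ω(n)`; used for `ω(n) ≥ 2`. Equivalently,
`τ(n) = (1 + λ(n) log n / (k log k))^k`. -/
noncomputable def lam (n : ℕ) : ℝ :=
  (((tau n : ℝ) ^ ((1 : ℝ) / (cardDistinctFactors n : ℝ)) - 1)
      * (cardDistinctFactors n : ℝ) * Real.log (cardDistinctFactors n : ℝ)) / Real.log (n : ℝ)

/-- The number `2^13 3^8 5^5 7^4 11^3 13^3 17^3 · 19^2 ⋯ 53^2 · 59 ⋯ 367`, whose prime factors are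
the first 73 primes. -/
def sharpExample : ℕ :=
  2 ^ 13 * 3 ^ 8 * 5 ^ 5 * 7 ^ 4 * 11 ^ 3 * 13 ^ 3 * 17 ^ 3
    * (∏ p ∈ (Finset.Icc 19 53).filter Nat.Prime, p ^ 2)
    * (∏ p ∈ (Finset.Icc 59 367).filter Nat.Prime, p)

/-!
Write `log τ(n) = ∑ log (a p + 1)` and `log n = ∑ a p log p` over the prime factors `p` of `n`, with
exponents `a p`. The bound says that `log τ(n)` lies below the concave function
`k log (1 + y / (k log k))` at `y = log n`. By duality, it is enough to show that
`log τ(n) - s log n < H_k(s)`, where `H_k` (`dualBound`) is the convex conjugate, for the slope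
`s = 1 / (log k + (log n) / k)` of that function at `log n`. For fixed `s` the left side is a sum
over the prime powers of `n`, so one can induct on the number `k` of primes, adding them in
increasing order.

* `dualBound_add_le`: passing from `k` to `k + 1` primes, `H_k(s)` grows by at least the
  contribution of the new prime power. This only needs the new prime `q` to satisfy
  `q ≥ 15 (k + 1) / 4`, which for `k ≥ 74` follows by counting residues prime to `30`
  (`le_of_le_count_prime`).
* `mul_log_card_le_sum_log`: the same induction gives `log n ≥ k log k`, hence
  `s ≤ 1 / (2 log k) ≤ 1 / (2 log 74)`, the range of slopes in which the case `k = 74` is needed.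
* `sum_lt_dualBound_of_card_eq`: the case `k = 74`. One may replace the primes of `n` by the first
  `74` primes (`sum_primes_le_sum_range`). For `s ≤ 8 / 97` the arithmetic-geometric mean inequality,
  which ignores that the exponents are integers, is strong enough. The remaining slopes are covered
  by four intervals. In each, `H_74` is bounded below by a tangent line, and `log τ(n) - s log n` is
  linear in `s`, so only the endpoints matter. There the maximum over `n` is attained at an explicit
  integer (`IsOptimal`), and the inequality becomes one between explicit natural numbers.

The claims about the number with 73 prime factors are verified from its factorization.
-/

/-! ### Powers and logarithms -/

lemma nat_mul_log_le_of_pow_le {a b m n : ℕ} (ha : 0 < a) (h : a ^ m ≤ b ^ n) :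
    m * Real.log a ≤ n * Real.log b := by
  rw [← Real.log_pow, ← Real.log_pow]
  exact Real.log_le_log (by positivity) (by exact_mod_cast h)

lemma nat_mul_log_lt_of_pow_lt {a b m n : ℕ} (ha : 0 < a) (h : a ^ m < b ^ n) :
    m * Real.log a < n * Real.log b := by
  rw [← Real.log_pow, ← Real.log_pow]
  exact Real.log_lt_log (by positivity) (by exact_mod_cast h)

lemma mul_log_add_one_sub_log_le_one {x : ℝ} (hx : 0 < x) :
    x * (Real.log (x + 1) - Real.log x) ≤ 1 := by
  rw [← Real.log_div (by positivity) hx.ne']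
  have := Real.log_le_sub_one_of_pos (show 0 < (x + 1) / x by positivity)
  calc x * Real.log ((x + 1) / x) ≤ x * ((x + 1) / x - 1) := by gcongr
    _ = 1 := by field_simp; ring

/-! ### Prime factorizations and ordered sets of primes -/

lemma log_tau_eq_sum {n : ℕ} (hn : n ≠ 0) :
    Real.log (tau n) = ∑ p ∈ n.primeFactors, Real.log (n.factorization p + 1) := by
  rw [tau, Nat.card_divisors hn, Nat.cast_prod, Real.log_prod]
  · simp
  · intro p _
    positivity

lemma log_eq_sum (n : ℕ) :
    Real.log n = ∑ p ∈ n.primeFactors, (n.factorization p : ℝ) * Real.log p := by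
  rw [Real.log_nat_eq_sum_factorization, Finsupp.sum, Nat.support_factorization]

lemma card_primeFactors_eq (n : ℕ) : n.primeFactors.card = cardDistinctFactors n := by
  rw [cardDistinctFactors_apply, ← List.card_toFinset]
  rfl

lemma card_le_count_prime {S : Finset ℕ} {q : ℕ} (hS : ∀ p ∈ S, p.Prime) (hq : ∀ p ∈ S, p < q) :
    S.card ≤ Nat.count Nat.Prime q := by
  rw [Nat.count_eq_card_filter_range]
  exact Finset.card_le_card fun p hp => by simp [hS p hp, hq p hp]

/-- The `i`-th smallest element of a set of primes has at least `i` primes below it, so a bound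
`φ i` valid for all such primes can be summed in increasing order. -/
lemma sum_primes_le_sum_range {g φ : ℕ → ℝ} (S : Finset ℕ) (hS : ∀ p ∈ S, p.Prime)
    (h : ∀ p ∈ S, ∀ i < S.card, i ≤ Nat.count Nat.Prime p → g p ≤ φ i) :
    ∑ p ∈ S, g p ≤ ∑ i ∈ Finset.range S.card, φ i := by
  induction S using Finset.induction_on_max with
  | empty => simp
  | insert q T hq ih =>
    have hqT : q ∉ T := fun hm => lt_irrefl _ (hq q hm)
    rw [Finset.card_insert_of_notMem hqT] at h ⊢
    have hT : ∀ p ∈ T, p.Prime := fun p hp => hS p (Finset.mem_insert_of_mem hp)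
    rw [Finset.sum_insert hqT, Finset.sum_range_succ, add_comm]
    exact add_le_add
      (ih hT fun p hp i hi hip => h p (Finset.mem_insert_of_mem hp) i (by omega) hip)
      (h q (Finset.mem_insert_self _ _) _ (by omega) (card_le_count_prime hT hq))

/-- If at least `k ≥ 74` primes lie below `q`, then `q ≥ 15 (k + 1) / 4`: beyond `368` the primes
avoid all but `φ(30) = 8` residues modulo `30`, so they have density at most `8 / 30 = 4 / 15`. -/
lemma le_of_le_count_prime {k q : ℕ} (hk : 74 ≤ k) (hkq : k ≤ Nat.count Nat.Prime q) :
    15 * (k + 1) ≤ 4 * q := by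
  have h73 : Nat.count Nat.Prime 368 = 73 := by decide +kernel
  have hq : 368 ≤ q := by
    by_contra! hlt
    have := Nat.count_monotone Nat.Prime hlt.le
    omega
  have h := Nat.primeCounting'_add_le (a := 30) (k := 368) (by norm_num) (by norm_num) (q - 368)
  have h8 : Nat.totient 30 = 8 := by decide +kernel
  rw [h8, Nat.add_sub_cancel' hq, Nat.primeCounting', h73] at h
  have : k ≤ 73 + 8 * ((q - 368) / 30 + 1) := hkq.trans h
  omega

/-- Induction on sets of at least `74` primes, adding the primes in increasing order. -/
lemma induction_primes {motive : Finset ℕ → Prop}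
    (base : ∀ S : Finset ℕ, (∀ p ∈ S, p.Prime) → S.card = 74 → motive S)
    (step : ∀ (S : Finset ℕ) (q : ℕ), q ∉ S → 74 ≤ S.card → 15 * (S.card + 1) ≤ 4 * q →
      motive S → motive (insert q S))
    (S : Finset ℕ) (hS : ∀ p ∈ S, p.Prime) (hk : 74 ≤ S.card) : motive S := by
  induction S using Finset.induction_on_max with
  | empty => simp at hk
  | insert q T hq ih =>
    have hqT : q ∉ T := fun hm => lt_irrefl _ (hq q hm)
    have hT : ∀ p ∈ T, p.Prime := fun p hp => hS p (Finset.mem_insert_of_mem hp)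
    rcases hk.eq_or_lt with h | h
    · exact base _ hS h.symm
    · rw [Finset.card_insert_of_notMem hqT] at h
      exact step T q hqT (by omega) (le_of_le_count_prime (by omega) (card_le_count_prime hT hq))
        (ih hT (by omega))

/-! ### The first 74 primes -/

/-- The first `74` primes. -/
def firstPrimes : List ℕ :=
  [2, 3, 5, 7, 11, 13, 17, 19, 23, 29, 31, 37, 41, 43, 47, 53, 59, 61, 67, 71, 73, 79, 83, 89, 97,
    101, 103, 107, 109, 113, 127, 131, 137, 139, 149, 151, 157, 163, 167, 173, 179, 181, 191, 193,
    197, 199, 211, 223, 227, 229, 233, 239, 241, 251, 257, 263, 269, 271, 277, 281, 283, 293, 307,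
    311, 313, 317, 331, 337, 347, 349, 353, 359, 367, 373]

/-- The `i`-th prime for `i < 74`, counting from `0`; the value `1` for larger `i` is junk. -/
def firstPrime (i : ℕ) : ℕ := firstPrimes.getD i 1

lemma count_firstPrime : ∀ i < 74, Nat.count Nat.Prime (firstPrime i) = i := by
  decide +kernel

lemma firstPrime_ge_two : ∀ i < 74, 2 ≤ firstPrime i := by
  decide +kernel

lemma firstPrime_le {p i : ℕ} (hp : p.Prime) (hi : i < 74) (hip : i ≤ Nat.count Nat.Prime p) :
    firstPrime i ≤ p := by
  by_contra! hlt
  have := Nat.count_strict_mono hp hlt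
  rw [count_firstPrime i hi] at this
  omega

lemma log_firstPrime_le {p i : ℕ} (hp : p.Prime) (hi : i < 74)
    (hip : i ≤ Nat.count Nat.Prime p) : Real.log (firstPrime i) ≤ Real.log p := by
  have := firstPrime_ge_two i hi
  exact Real.log_le_log (by exact_mod_cast (by omega : 0 < firstPrime i))
    (by exact_mod_cast firstPrime_le hp hi hip)

/-! ### The dual bound and its growth with the number of primes -/

/-- The maximum over `y ≥ 0` of `k log (1 + y / (k log k)) - s y`, for `0 < s ≤ 1 / log k` (the
formula is used as a definition for all `s`). The upper bound for `τ(n)` follows from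
`log τ(n) - s log n < dualBound k s` at the maximizing slope `s` for `y = log n`. -/
noncomputable def dualBound (k : ℕ) (s : ℝ) : ℝ :=
  k * (s * Real.log k - 1 - Real.log (s * Real.log k))

/-- The dual bound grows by at least the contribution of a new prime power `q ^ a`. The terms in
`a` are bounded by the tangent of `log` at `log k' / (log k' + 1.15)`, where `k' = k + 1`. -/
lemma dualBound_add_le {k q a : ℕ} {s : ℝ} (hk : 74 ≤ k) (hq : 15 * (k + 1) ≤ 4 * q)
    (ha : 1 ≤ a) (hs : 0 < s) :
    dualBound k s + (Real.log (a + 1) - s * (a * Real.log q)) ≤ dualBound (k + 1) s := by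
  have hk0 : (74 : ℝ) ≤ k := by exact_mod_cast hk
  have ha1 : (1 : ℝ) ≤ a := by exact_mod_cast ha
  have hQ : Real.log ((k : ℝ) + 1) + 1.32 ≤ Real.log q := by
    have h1 : (1.32 : ℝ) ≤ Real.log (15 / 4) := by
      have h : Real.exp 1 ^ 33 ≤ (15 / 4 : ℝ) ^ 25 :=
        (pow_le_pow_left₀ (Real.exp_pos 1).le Real.exp_one_lt_d9.le 33).trans (by norm_num)
      have := Real.log_le_log (by positivity) h
      rw [Real.log_pow, Real.log_pow, Real.log_exp] at this
      norm_num at this ⊢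
      linarith
    have h2 : (15 / 4 : ℝ) * (k + 1) ≤ q := by
      have : (15 : ℝ) * (k + 1) ≤ 4 * q := by exact_mod_cast hq
      linarith
    have h3 := Real.log_le_log (by positivity) h2
    rw [Real.log_mul (by norm_num) (by positivity)] at h3
    linarith
  have hL : (4.2 : ℝ) ≤ Real.log k := by
    have h : Real.exp 1 ^ 21 ≤ (k : ℝ) ^ 5 :=
      (pow_le_pow_left₀ (Real.exp_pos 1).le Real.exp_one_lt_d9.le 21).trans
        ((by norm_num : (2.7182818286 : ℝ) ^ 21 ≤ 74 ^ 5).trans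
          (pow_le_pow_left₀ (by norm_num) hk0 5))
    have := Real.log_le_log (by positivity) h
    rw [Real.log_pow, Real.log_pow, Real.log_exp] at this
    norm_num at this ⊢
    linarith
  -- `ε = log (k + 1) - log k` satisfies `74 / 75 ≤ k ε ≤ 1`.
  have hε1 : k * (Real.log ((k : ℝ) + 1) - Real.log k) ≤ 1 :=
    mul_log_add_one_sub_log_le_one (by positivity)
  have hε2 : (74 / 75 : ℝ) ≤ k * (Real.log ((k : ℝ) + 1) - Real.log k) := by
    rw [← Real.log_div (by positivity) (by positivity)]
    have := Real.one_sub_inv_le_log_of_pos (show 0 < ((k : ℝ) + 1) / k by positivity)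
    calc (74 / 75 : ℝ) ≤ k * (1 - (((k : ℝ) + 1) / k)⁻¹) := by
          rw [inv_div, one_sub_div (by positivity), add_sub_cancel_left, mul_one_div,
            div_le_div_iff₀ (by norm_num) (by positivity)]
          linarith
      _ ≤ _ := by gcongr
  unfold dualBound
  push_cast
  set L := Real.log (k : ℝ)
  set L' := Real.log ((k : ℝ) + 1)
  have hL0 : 0 < L := by linarith
  have hLL : L' ≤ L + 1 / 74 := by
    by_contra! h
    nlinarith
  have hL'1 : L ≤ L' := by
    by_contra! h
    nlinarith
  have hL'0 : 0 < L' := by linarith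
  have hquot : k * (Real.log L' - Real.log L) ≤ k * (L' - L) * (1 / L) := by
    rw [← Real.log_div hL'0.ne' hL0.ne']
    have := Real.log_le_sub_one_of_pos (show 0 < L' / L by positivity)
    calc k * Real.log (L' / L) ≤ k * (L' / L - 1) := by gcongr
      _ = _ := by field_simp
  have hr : 1 / L ≤ Real.log (1 + 1.15 / L') := by
    refine le_trans ?_ (Real.le_log_one_add_of_nonneg (by positivity))
    rw [show 2 * (1.15 / L') / (1.15 / L' + 2) = 2.3 / (1.15 + 2 * L') by field_simp; ring,
      div_le_div_iff₀ hL0 (by positivity)]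
    linarith
  have htan : Real.log s + Real.log L' + Real.log (a + 1) + Real.log (1 + 1.15 / L') ≤
      (a + 1) * s * (L' + 1.15) - 1 := by
    have h := Real.log_le_sub_one_of_pos
      (show 0 < s * L' * (a + 1) * (1 + 1.15 / L') by positivity)
    rw [Real.log_mul (by positivity) (by positivity), Real.log_mul (by positivity) (by positivity),
      Real.log_mul (by positivity) (by positivity)] at h
    refine h.trans_eq ?_
    field_simp
  have hinv : k * (L' - L) * (1 / L) ≤ 1 / L := by
    have : 0 < 1 / L := by positivity
    nlinarith
  have hsa : s * (a * (L' + 1.32)) ≤ s * (a * Real.log q) := by gcongr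
  have hsε : s * (74 / 75) ≤ s * (k * (L' - L)) := by gcongr
  have hss : s ≤ s * a := le_mul_of_one_le_right hs.le ha1
  rw [Real.log_mul hs.ne' hL0.ne', Real.log_mul hs.ne' hL'0.ne']
  nlinarith

/-! ### The case of 74 primes -/

/-- A line through the graph of `log` at `b + 1` whose slope `d` lies between those of the chords over
`[b + 1, b + 2]` and `[b, b + 1]` is above `log` at all positive integers, by Bernoulli's
inequality. -/
lemma log_add_one_le_integer_tangent {a b : ℕ} {d : ℝ} (hb : 1 ≤ b)
    (h₁ : Real.log (b + 2) - Real.log (b + 1) ≤ d) (h₂ : d ≤ Real.log (b + 1) - Real.log b) :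
    Real.log (a + 1) ≤ Real.log (b + 1) + (a - b) * d := by
  have hb0 : (0 : ℝ) < b := by exact_mod_cast hb
  rcases le_total b a with hab | hab
  · obtain ⟨m, rfl⟩ := Nat.exists_eq_add_of_le hab
    have h := one_add_mul_le_pow (a := 1 / ((b : ℝ) + 1)) (by
      have : 0 < 1 / ((b : ℝ) + 1) := by positivity
      linarith) m
    have h' := Real.log_le_log (by positivity) h
    rw [show 1 + (m : ℝ) * (1 / (b + 1)) = (b + m + 1) / (b + 1) by field_simp; ring,
      show 1 + 1 / ((b : ℝ) + 1) = (b + 2) / (b + 1) by field_simp; ring, Real.log_pow,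
      Real.log_div (by positivity) (by positivity),
      Real.log_div (by positivity) (by positivity)] at h'
    have : (m : ℝ) * (Real.log (b + 2) - Real.log (b + 1)) ≤ m * d := by gcongr
    push_cast
    linarith
  · obtain ⟨m, rfl⟩ := Nat.exists_eq_add_of_le hab
    push_cast at *
    have h := one_add_mul_le_pow (a := -(1 / ((a : ℝ) + m + 1))) (by
      have : 1 / ((a : ℝ) + m + 1) ≤ 1 := by
        rw [div_le_one (by positivity)]
        linarith
      linarith) m
    rw [show 1 + (m : ℝ) * -(1 / (a + m + 1)) = (a + 1) / (a + m + 1) by field_simp; ring,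
      show 1 + -(1 / ((a : ℝ) + m + 1)) = (a + m) / (a + m + 1) by field_simp; ring] at h
    have h' := Real.log_le_log (by positivity) h
    rw [Real.log_pow, Real.log_div (by positivity) (by positivity),
      Real.log_div (by positivity) (by positivity)] at h'
    have : (m : ℝ) * d ≤ m * (Real.log (a + m + 1) - Real.log (a + m)) := by gcongr
    linarith

/-- `b` is the list of exponents, continued by ones, of an integer `N` with the first `74` primes as
prime factors that maximizes `log τ(N) - (t / M) log N`: each exponent satisfies the local
optimality condition `(b + 2) / (b + 1) ≤ p ^ (t / M) ≤ (b + 1) / b`. -/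
def IsOptimal (t M : ℕ) (b : List ℕ) : Prop :=
  ∀ i < 74, 1 ≤ b.getD i 1 ∧
    (b.getD i 1 + 2) ^ M ≤ firstPrime i ^ t * (b.getD i 1 + 1) ^ M ∧
    firstPrime i ^ t * b.getD i 1 ^ M ≤ (b.getD i 1 + 1) ^ M

instance (t M : ℕ) (b : List ℕ) : Decidable (IsOptimal t M b) := by
  unfold IsOptimal
  infer_instance

/-- The exponentiated form of the statement that, for the integer `N` encoded by `b` as in
`IsOptimal`, the number `log τ(N) - (t / M) log N` is less than the value at `s = t / M` of the
tangent line of `dualBound 74` at the point where `s log 74 = D / (D + m)`. -/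
def IsBelowTangent (t M m D : ℕ) (b : List ℕ) : Prop :=
  (∏ i ∈ Finset.range 74, (b.getD i 1 + 1)) ^ (M * D) * 74 ^ (74 * (t * m)) *
      D ^ (74 * (M * D)) <
    (∏ i ∈ Finset.range 74, firstPrime i ^ b.getD i 1) ^ (t * D) * (D + m) ^ (74 * (M * D))

instance (t M m D : ℕ) (b : List ℕ) : Decidable (IsBelowTangent t M m D b) :=
  inferInstanceAs (Decidable (_ < _))

lemma sum_lt_tangent {t M m D : ℕ} {b : List ℕ} (hM : 0 < M) (hD : 0 < D)
    (hb : IsOptimal t M b)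
    (hlt : IsBelowTangent t M m D b)
    {S : Finset ℕ} (hS : ∀ p ∈ S, p.Prime) (hcard : S.card = 74) (a : ℕ → ℕ) :
    ∑ p ∈ S, Real.log (a p + 1) - t / M * ∑ p ∈ S, (a p : ℝ) * Real.log p <
      74 * (Real.log ((D + m) / D) - t / M * Real.log 74 * (m / D)) := by
  have hM' : (0 : ℝ) < M := by exact_mod_cast hM
  have hD' : (0 : ℝ) < D := by exact_mod_cast hD
  have hP : ∀ i ∈ Finset.range 74, (0 : ℝ) < firstPrime i := fun i hi => by
    have := firstPrime_ge_two i (Finset.mem_range.mp hi)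
    exact_mod_cast (by omega : 0 < firstPrime i)
  have hle : ∑ p ∈ S, (Real.log (a p + 1) - t / M * (a p * Real.log p)) ≤
      ∑ i ∈ Finset.range S.card, (Real.log (b.getD i 1 + 1) -
        t / M * (b.getD i 1 * Real.log (firstPrime i))) := by
    refine sum_primes_le_sum_range S hS fun p hp i hi hip => ?_
    rw [hcard] at hi
    obtain ⟨h1, h2, h3⟩ := hb i hi
    have hPi := hP i (Finset.mem_range.mpr hi)
    set e := b.getD i 1
    have he : (0 : ℝ) < e := by exact_mod_cast h1
    have h2' : ((e : ℝ) + 2) ^ M ≤ (firstPrime i : ℝ) ^ t * (e + 1) ^ M := by exact_mod_cast h2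
    have h3' : (firstPrime i : ℝ) ^ t * (e : ℝ) ^ M ≤ (e + 1) ^ M := by exact_mod_cast h3
    have h2'' := Real.log_le_log (by positivity) h2'
    have h3'' := Real.log_le_log (by positivity) h3'
    rw [Real.log_mul (by positivity) (by positivity)] at h2'' h3''
    simp only [Real.log_pow] at h2'' h3''
    have htan := log_add_one_le_integer_tangent (a := a p) (d := t / M * Real.log (firstPrime i))
      h1 (by
        rw [div_mul_eq_mul_div, le_div_iff₀ hM']
        linarith) (by
        rw [div_mul_eq_mul_div, div_le_iff₀ hM']
        linarith)
    have hlog : (t : ℝ) / M * (a p * Real.log (firstPrime i)) ≤ t / M * (a p * Real.log p) := by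
      gcongr
      exact firstPrime_le (hS p hp) hi hip
    linarith
  rw [hcard, Finset.sum_sub_distrib, Finset.sum_sub_distrib, ← Finset.mul_sum,
    ← Finset.mul_sum] at hle
  refine hle.trans_lt ?_
  have hlt' : (∏ i ∈ Finset.range 74, ((b.getD i 1 : ℝ) + 1)) ^ (M * D) * 74 ^ (74 * (t * m)) *
        (D : ℝ) ^ (74 * (M * D)) <
      (∏ i ∈ Finset.range 74, (firstPrime i : ℝ) ^ b.getD i 1) ^ (t * D) *
        ((D : ℝ) + m) ^ (74 * (M * D)) := by exact_mod_cast hlt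
  have hA : (0 : ℝ) < ∏ i ∈ Finset.range 74, ((b.getD i 1 : ℝ) + 1) :=
    Finset.prod_pos fun i _ => by positivity
  have hB : (0 : ℝ) < ∏ i ∈ Finset.range 74, (firstPrime i : ℝ) ^ b.getD i 1 :=
    Finset.prod_pos fun i hi => pow_pos (hP i hi) _
  have h := Real.log_lt_log (by positivity) hlt'
  rw [Real.log_mul (by positivity) (by positivity), Real.log_mul (by positivity) (by positivity),
    Real.log_mul (by positivity) (by positivity)] at h
  simp only [Real.log_pow] at h
  rw [Real.log_prod fun i _ => by positivity,
    Real.log_prod fun i hi => (pow_pos (hP i hi) _).ne'] at h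
  simp only [Real.log_pow] at h
  rw [Real.log_div (by positivity) (by positivity)]
  push_cast at h
  refine lt_of_mul_lt_mul_left ?_ (show (0 : ℝ) ≤ M * D by positivity)
  field_simp
  linarith

/-- Between two slopes at which the inequality with one common tangent line of the convex function
`dualBound 74` holds, the inequality with `dualBound 74` follows, by linearity in the slope. -/
lemma lt_dualBound_of_endpoints {s s₀ s₁ A B : ℝ} {m D : ℕ} (hD : 0 < D) (hs : 0 < s)
    (h₀ : s₀ ≤ s) (h₁ : s ≤ s₁)
    (hA₀ : A - s₀ * B < 74 * (Real.log ((D + m) / D) - s₀ * Real.log 74 * (m / D)))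
    (hA₁ : A - s₁ * B < 74 * (Real.log ((D + m) / D) - s₁ * Real.log 74 * (m / D))) :
    A - s * B < dualBound 74 s := by
  have hL : 0 < Real.log 74 := Real.log_pos (by norm_num)
  have hD' : (0 : ℝ) < D := by exact_mod_cast hD
  have hlin : A - s * B < 74 * (Real.log ((D + m) / D) - s * Real.log 74 * (m / D)) := by
    rcases le_total B (74 * (Real.log 74 * (m / D))) with h | h <;> nlinarith
  refine hlin.trans_le ?_
  have h := Real.log_le_sub_one_of_pos
    (show 0 < s * Real.log 74 * (((D : ℝ) + m) / D) by positivity)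
  rw [Real.log_mul (by positivity) (by positivity)] at h
  have hsplit : s * Real.log 74 * (((D : ℝ) + m) / D) =
      s * Real.log 74 + s * Real.log 74 * (m / D) := by
    field_simp
  unfold dualBound
  push_cast
  linarith

lemma sum_lt_dualBound_of_mem_Icc (t₀ M₀ t₁ M₁ m D : ℕ) {b₀ b₁ : List ℕ} (hM₀ : 0 < M₀)
    (hM₁ : 0 < M₁) (hD : 0 < D) (o₀ : IsOptimal t₀ M₀ b₀) (o₁ : IsOptimal t₁ M₁ b₁)
    (c₀ : IsBelowTangent t₀ M₀ m D b₀) (c₁ : IsBelowTangent t₁ M₁ m D b₁)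
    {S : Finset ℕ} (hS : ∀ p ∈ S, p.Prime) (hcard : S.card = 74) (a : ℕ → ℕ)
    {s : ℝ} (hs : 0 < s) (h₀ : (t₀ : ℝ) / M₀ ≤ s) (h₁ : s ≤ (t₁ : ℝ) / M₁) :
    ∑ p ∈ S, Real.log (a p + 1) - s * ∑ p ∈ S, (a p : ℝ) * Real.log p < dualBound 74 s :=
  lt_dualBound_of_endpoints hD hs h₀ h₁ (sum_lt_tangent hM₀ hD o₀ c₀ hS hcard a)
    (sum_lt_tangent hM₁ hD o₁ c₁ hS hcard a)

/-- Lower approximations `r` of `400 log p / log 74` for the first `74` primes `p`. -/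
def logRatios : List ℕ :=
  [64, 102, 149, 180, 222, 238, 263, 273, 291, 312, 319, 335, 345, 349, 357, 368, 378, 382,
    390, 396, 398, 406, 410, 417, 425, 428, 430, 434, 435, 439, 450, 453, 457, 458, 465, 466,
    469, 473, 475, 478, 482, 483, 488, 489, 490, 491, 497, 502, 504, 504, 506, 508, 509, 513,
    515, 517, 519, 520, 522, 524, 524, 527, 532, 533, 534, 535, 539, 540, 543, 544, 545, 546,
    548, 550]

lemma logRatios_spec : ∀ i < 74, 1 ≤ logRatios.getD i 1 ∧
    74 ^ logRatios.getD i 1 ≤ firstPrime i ^ 400 := by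
  decide +kernel

/-- For small slopes the inequality between arithmetic and geometric means suffices: with
`log p ≥ r log 74` and `u = s log 74`, it bounds the contribution of `p` by `u r - 1 - log (u r)`
for real exponents. -/
lemma lt_dualBound_of_le {S : Finset ℕ} (hS : ∀ p ∈ S, p.Prime) (hcard : S.card = 74) (a : ℕ → ℕ)
    {s : ℝ} (hs : 0 < s) (hs' : s ≤ 8 / 97) :
    ∑ p ∈ S, Real.log (a p + 1) - s * ∑ p ∈ S, (a p : ℝ) * Real.log p < dualBound 74 s := by
  have hL : 0 < Real.log 74 := Real.log_pos (by norm_num)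
  set u := s * Real.log 74 with hu
  have hu0 : 0 < u := by positivity
  have hr : ∀ i ∈ Finset.range 74, (0 : ℝ) < logRatios.getD i 1 / 400 := fun i hi => by
    have : (0 : ℝ) < logRatios.getD i 1 := by
      exact_mod_cast (logRatios_spec i (Finset.mem_range.mp hi)).1
    positivity
  have hle : ∑ p ∈ S, (Real.log (a p + 1) - s * (a p * Real.log p)) ≤
      ∑ i ∈ Finset.range S.card, (u * ((logRatios.getD i 1 : ℝ) / 400) - 1 - Real.log u -
        Real.log ((logRatios.getD i 1 : ℝ) / 400)) := by
    refine sum_primes_le_sum_range S hS fun p hp i hi hip => ?_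
    rw [hcard] at hi
    have hri := hr i (Finset.mem_range.mpr hi)
    have h := nat_mul_log_le_of_pow_le (by norm_num) (logRatios_spec i hi).2
    push_cast at h
    set r := (logRatios.getD i 1 : ℝ) / 400 with hrdef
    have hrp : r * Real.log 74 ≤ Real.log p := by
      refine le_trans ?_ (log_firstPrime_le (hS p hp) hi hip)
      rw [hrdef]
      linarith
    have hlog := Real.log_le_sub_one_of_pos (show 0 < (a p + 1) * (u * r) by positivity)
    rw [Real.log_mul (by positivity) (by positivity), Real.log_mul (by positivity) hri.ne'] at hlog
    have hmul : s * (a p * (r * Real.log 74)) ≤ s * (a p * Real.log p) := by gcongr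
    have : s * (a p * (r * Real.log 74)) = a p * (u * r) := by
      rw [hu]
      ring
    linarith
  rw [hcard, Finset.sum_sub_distrib, ← Finset.mul_sum] at hle
  refine hle.trans_lt ?_
  rw [Finset.sum_sub_distrib, Finset.sum_sub_distrib, Finset.sum_sub_distrib, ← Finset.mul_sum,
    ← Real.log_prod fun i hi => (hr i hi).ne', ← Finset.sum_div, Finset.prod_div_distrib]
  have hsum : ∑ i ∈ Finset.range 74, (logRatios.getD i 1 : ℝ) ≤ 29600 + 27 * 97 := by
    have : ∑ i ∈ Finset.range 74, logRatios.getD i 1 ≤ 29600 + 27 * 97 := by decide +kernel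
    exact_mod_cast this
  have hprod : 27 / 50 * Real.log 74 < Real.log ((∏ i ∈ Finset.range 74,
      (logRatios.getD i 1 : ℝ)) / ∏ i ∈ Finset.range 74, (400 : ℝ)) := by
    have hnat : 74 ^ 27 * (400 ^ 74) ^ 50 <
        (∏ i ∈ Finset.range 74, logRatios.getD i 1) ^ 50 := by decide +kernel
    have hreal : (74 : ℝ) ^ 27 * (400 ^ 74) ^ 50 <
        (∏ i ∈ Finset.range 74, (logRatios.getD i 1 : ℝ)) ^ 50 := by exact_mod_cast hnat
    rw [Finset.prod_const, Finset.card_range]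
    rw [← lt_div_iff₀ (by positivity), ← div_pow] at hreal
    have := Real.log_lt_log (by positivity) hreal
    simp only [Real.log_pow] at this
    push_cast at this
    linarith
  have hus : u ≤ 8 / 97 * Real.log 74 := by
    rw [hu]
    gcongr
  simp only [Finset.sum_const, Finset.card_range, nsmul_eq_mul]
  unfold dualBound
  push_cast
  rw [← hu]
  nlinarith

/-- The dual inequality for `74` primes. The slopes beyond `8 / 97` are cut at `8 / 85`, `6 / 61`
and `10 / 99`. -/
lemma sum_lt_dualBound_of_card_eq {S : Finset ℕ} (hS : ∀ p ∈ S, p.Prime) (hcard : S.card = 74)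
    (a : ℕ → ℕ) {s : ℝ} (hs : 0 < s) (hs' : s * (2 * Real.log 74) ≤ 1) :
    ∑ p ∈ S, Real.log (a p + 1) - s * ∑ p ∈ S, (a p : ℝ) * Real.log p < dualBound 74 s := by
  rcases le_total s (8 / 97) with h₀ | h₀
  · exact lt_dualBound_of_le hS hcard a hs h₀
  have o₀ : IsOptimal 8 97 [16, 10, 7, 5, 4, 4, 3, 3, 3, 3, 3, 2, 2, 2, 2, 2, 2, 2, 2, 2, 2, 2, 2,
    2, 2, 2, 2, 2, 2, 2, 2, 2] := by decide +kernel
  have o₁ : IsOptimal 8 85 [14, 9, 6, 4, 3, 3, 3, 3, 2, 2, 2, 2, 2, 2, 2, 2, 2, 2, 2, 2, 2] := by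
    decide +kernel
  have o₂ : IsOptimal 6 61 [14, 8, 5, 4, 3, 3, 3, 2, 2, 2, 2, 2, 2, 2, 2, 2, 2, 2] := by
    decide +kernel
  have o₃ : IsOptimal 10 99 [13, 8, 5, 4, 3, 3, 3, 2, 2, 2, 2, 2, 2, 2, 2, 2] := by
    decide +kernel
  have o₄ : IsOptimal 5 43 [11, 7, 4, 3, 3, 2, 2, 2, 2, 2, 2] := by decide +kernel
  rcases le_total s (8 / 85) with h₁ | h₁
  · exact sum_lt_dualBound_of_mem_Icc 8 97 8 85 25 16 (by norm_num) (by norm_num) (by norm_num) o₀ o₁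
      (by decide +kernel) (by decide +kernel) hS hcard a hs (by exact_mod_cast h₀)
      (by exact_mod_cast h₁)
  rcases le_total s (6 / 61) with h₂ | h₂
  · exact sum_lt_dualBound_of_mem_Icc 8 85 6 61 11 8 (by norm_num) (by norm_num) (by norm_num) o₁ o₂
      (by decide +kernel) (by decide +kernel) hS hcard a hs (by exact_mod_cast h₁)
      (by exact_mod_cast h₂)
  rcases le_total s (10 / 99) with h₃ | h₃
  · exact sum_lt_dualBound_of_mem_Icc 6 61 10 99 4 3 (by norm_num) (by norm_num) (by norm_num) o₂ o₃
      (by decide +kernel) (by decide +kernel) hS hcard a hs (by exact_mod_cast h₂)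
      (by exact_mod_cast h₃)
  -- `1 / (2 log 74) ≤ 5 / 43`, that is `log 74 ≥ 4.3`.
  have h₄ : s ≤ 5 / 43 := by
    have h : Real.exp 1 ^ 43 ≤ (74 : ℝ) ^ 10 :=
      (pow_le_pow_left₀ (Real.exp_pos 1).le Real.exp_one_lt_d9.le 43).trans (by norm_num)
    have := Real.log_le_log (by positivity) h
    rw [Real.log_pow, Real.log_pow, Real.log_exp] at this
    push_cast at this
    nlinarith
  exact sum_lt_dualBound_of_mem_Icc 10 99 5 43 19 15 (by norm_num) (by norm_num) (by norm_num) o₃ o₄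
      (by decide +kernel) (by decide +kernel) hS hcard a hs (by exact_mod_cast h₃)
      (by exact_mod_cast h₄)

/-! ### The number with 73 prime factors -/

/-- The exponent of the prime `p ≤ 367` in `sharpExample`. -/
def sharpExponent (p : ℕ) : ℕ :=
  if p ≤ 2 then 13 else if p ≤ 3 then 8 else if p ≤ 5 then 5 else if p ≤ 7 then 4
  else if p ≤ 17 then 3 else if p ≤ 53 then 2 else 1

lemma sharpExponent_ne_zero (p : ℕ) : sharpExponent p ≠ 0 := by
  unfold sharpExponent
  split_ifs <;> decide

/-- The set of the first 73 primes. -/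
def sharpPrimes : Finset ℕ := (firstPrimes.take 73).toFinset

lemma prime_of_mem_sharpPrimes : ∀ p ∈ sharpPrimes, p.Prime := by decide +kernel

lemma sharpExample_eq_prod : sharpExample = ∏ p ∈ sharpPrimes, p ^ sharpExponent p := by
  decide +kernel

/-- The factorization of `sharpExample`. -/
noncomputable def sharpFactorization : ℕ →₀ ℕ :=
  Finsupp.indicator sharpPrimes fun p _ => sharpExponent p

lemma support_sharpFactorization : sharpFactorization.support = sharpPrimes := by
  ext p
  by_cases hp : p ∈ sharpPrimes <;>
    simp [sharpFactorization, Finsupp.indicator_apply, hp, sharpExponent_ne_zero]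

lemma sharpFactorization_apply {p : ℕ} (hp : p ∈ sharpPrimes) :
    sharpFactorization p = sharpExponent p := by
  simp [sharpFactorization, Finsupp.indicator_apply, hp]

lemma factorization_sharpExample : sharpExample.factorization = sharpFactorization := by
  have h : sharpExample = sharpFactorization.prod fun p e => p ^ e := by
    rw [Finsupp.prod, support_sharpFactorization, sharpExample_eq_prod]
    exact Finset.prod_congr rfl fun p hp => by rw [sharpFactorization_apply hp]
  rw [h]
  refine Nat.prod_pow_factorization_eq_self fun p hp => ?_
  rw [support_sharpFactorization] at hp
  exact prime_of_mem_sharpPrimes p hp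

lemma primeFactors_sharpExample : sharpExample.primeFactors = sharpPrimes := by
  rw [← Nat.support_factorization, factorization_sharpExample, support_sharpFactorization]

lemma cardDistinctFactors_sharpExample : cardDistinctFactors sharpExample = 73 := by
  rw [← card_primeFactors_eq, primeFactors_sharpExample]
  decide +kernel

lemma sharpExample_gt_one : 1 < sharpExample := by
  rw [sharpExample_eq_prod]
  decide +kernel

lemma tau_sharpExample : tau sharpExample = ∏ p ∈ sharpPrimes, (sharpExponent p + 1) := by
  rw [tau, Nat.card_divisors sharpExample_gt_one.ne_bot, primeFactors_sharpExample,
    factorization_sharpExample]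
  exact Finset.prod_congr rfl fun p hp => by rw [sharpFactorization_apply hp]

/-- The fraction `145 / 109` separates `τ(n)^{1/73} - 1` from `log n / (73 log 73)`. -/
lemma one_lt_lam_sharpExample : 1 < lam sharpExample := by
  have h1 : (254 : ℕ) ^ 73 ≤ tau sharpExample * 109 ^ 73 := by
    rw [tau_sharpExample]
    decide +kernel
  have h2 : sharpExample ^ 109 < 73 ^ (73 * 145) := by
    rw [sharpExample_eq_prod]
    decide +kernel
  have hn : (1 : ℝ) < sharpExample := by exact_mod_cast sharpExample_gt_one
  have hlog : 0 < Real.log (sharpExample : ℝ) := Real.log_pos hn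
  have hL : 0 < Real.log 73 := Real.log_pos (by norm_num)
  have hroot : (254 / 109 : ℝ) ≤ (tau sharpExample : ℝ) ^ ((1 : ℝ) / 73) := by
    have h1' : (254 : ℝ) ^ 73 ≤ tau sharpExample * 109 ^ 73 := by exact_mod_cast h1
    have : ((254 / 109 : ℝ)) ^ 73 ≤ tau sharpExample := by
      rw [div_pow]
      exact (div_le_iff₀ (by positivity)).mpr h1'
    calc (254 / 109 : ℝ) = ((254 / 109 : ℝ) ^ 73) ^ ((1 : ℝ) / 73) := by
          rw [one_div]
          exact (Real.pow_rpow_inv_natCast (n := 73) (by norm_num) (by norm_num)).symm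
      _ ≤ _ := Real.rpow_le_rpow (by positivity) this (by norm_num)
  have hlt : (109 : ℕ) * Real.log sharpExample < (73 * 145 : ℕ) * Real.log (73 : ℕ) :=
    nat_mul_log_lt_of_pow_lt (zero_lt_one.trans sharpExample_gt_one) h2
  push_cast at hlt
  rw [lam, cardDistinctFactors_sharpExample, lt_div_iff₀ hlog, one_mul]
  push_cast
  have : (145 / 109 : ℝ) * 73 * Real.log 73 ≤
      ((tau sharpExample : ℝ) ^ ((1 : ℝ) / 73) - 1) * 73 * Real.log 73 := by
    gcongr
    linarith
  linarith

/-! ### Arbitrarily many primes -/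

/-- A product of `k ≥ 74` distinct primes is at least `k ^ k`. -/
lemma mul_log_card_le_sum_log (S : Finset ℕ) (hS : ∀ p ∈ S, p.Prime) (hk : 74 ≤ S.card) :
    S.card * Real.log S.card ≤ ∑ p ∈ S, Real.log p := by
  refine induction_primes (motive := fun S => S.card * Real.log S.card ≤ ∑ p ∈ S, Real.log p)
    (fun S hS hcard => ?_) (fun S q hqS hk hq ih => ?_) S hS hk
  · have h := sum_primes_le_sum_range (g := fun p => -Real.log p)
      (φ := fun i => -Real.log (firstPrime i)) S hS fun p hp i hi hip =>
        neg_le_neg (log_firstPrime_le (hS p hp) (hcard ▸ hi) hip)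
    rw [Finset.sum_neg_distrib, Finset.sum_neg_distrib, neg_le_neg_iff, hcard,
      ← Real.log_prod fun i hi => by
        have := firstPrime_ge_two i (Finset.mem_range.mp hi)
        exact_mod_cast (by omega : firstPrime i ≠ 0)] at h
    have hnat : 74 ^ 74 ≤ (∏ i ∈ Finset.range 74, firstPrime i) ^ 1 := by decide +kernel
    have := nat_mul_log_le_of_pow_le (by norm_num) hnat
    rw [hcard]
    push_cast at this ⊢
    linarith
  · rw [Finset.sum_insert hqS, Finset.card_insert_of_notMem hqS]
    set k := S.card
    have hk0 : (74 : ℝ) ≤ k := by exact_mod_cast hk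
    have hε := mul_log_add_one_sub_log_le_one (show 0 < (k : ℝ) by linarith)
    have hQ : 1 + Real.log ((k : ℝ) + 1) ≤ Real.log q := by
      have h2 : Real.exp 1 * ((k : ℝ) + 1) ≤ q := by
        have : (15 : ℝ) * (k + 1) ≤ 4 * q := by exact_mod_cast hq
        nlinarith [Real.exp_one_lt_d9]
      have h3 := Real.log_le_log (by positivity) h2
      rwa [Real.log_mul (by positivity) (by positivity), Real.log_exp] at h3
    push_cast
    linarith

/-- The dual inequality for all sets of at least `74` primes. Its slope stays fixed during the
induction: `s ≤ 1 / (2 log 74)` covers what is needed for every `k ≥ 74`. -/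
lemma sum_lt_dualBound (a : ℕ → ℕ) {s : ℝ} (hs : 0 < s) (S : Finset ℕ) (hS : ∀ p ∈ S, p.Prime)
    (hk : 74 ≤ S.card) (ha : ∀ p ∈ S, 1 ≤ a p) (hs' : s * (2 * Real.log 74) ≤ 1) :
    ∑ p ∈ S, Real.log (a p + 1) - s * ∑ p ∈ S, (a p : ℝ) * Real.log p <
      dualBound S.card s := by
  revert ha
  refine induction_primes (motive := fun S => (∀ p ∈ S, 1 ≤ a p) →
      ∑ p ∈ S, Real.log (a p + 1) - s * ∑ p ∈ S, (a p : ℝ) * Real.log p < dualBound S.card s)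
    (fun S hS hcard _ => ?_) (fun S q hqS hk hq ih ha => ?_) S hS hk
  · rw [hcard]
    exact sum_lt_dualBound_of_card_eq hS hcard a hs hs'
  · rw [Finset.sum_insert hqS, Finset.sum_insert hqS, Finset.card_insert_of_notMem hqS]
    have h1 := ih fun p hp => ha p (Finset.mem_insert_of_mem hp)
    have h2 := dualBound_add_le hk hq (ha q (Finset.mem_insert_self _ _)) hs
    linarith

/-- The slope `s = k / (k log k + log n)` is that of `y ↦ k log (1 + y / (k log k))` at
`y = log n`. -/
lemma tau_lt_pow {n k : ℕ} (hn : 0 < n) (hk : k = cardDistinctFactors n) (h74 : 74 ≤ k) :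
    (tau n : ℝ) < (1 + Real.log n / (k * Real.log k)) ^ k := by
  have hcard : n.primeFactors.card = k := by rw [card_primeFactors_eq, hk]
  have hS : ∀ p ∈ n.primeFactors, p.Prime := fun p hp => Nat.prime_of_mem_primeFactors hp
  have hfac : ∀ p ∈ n.primeFactors, 1 ≤ n.factorization p := fun p hp =>
    (hS p hp).factorization_pos_of_dvd hn.ne' (Nat.dvd_of_mem_primeFactors hp)
  have hk0 : (74 : ℝ) ≤ k := by exact_mod_cast h74
  have hL74 : 0 < Real.log 74 := Real.log_pos (by norm_num)
  have hL : Real.log 74 ≤ Real.log k := Real.log_le_log (by norm_num) hk0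
  have hL0 : 0 < Real.log k := hL74.trans_le hL
  have hkpos : (0 : ℝ) < k := by linarith
  have hlogn : k * Real.log k ≤ Real.log n := by
    have h := mul_log_card_le_sum_log n.primeFactors hS (by omega)
    rw [hcard] at h
    rw [log_eq_sum n]
    refine h.trans (Finset.sum_le_sum fun p hp => le_mul_of_one_le_left ?_ ?_)
    · exact Real.log_natCast_nonneg p
    · exact_mod_cast hfac p hp
  set y := Real.log (n : ℝ)
  set L := Real.log (k : ℝ)
  have hkL : 0 < k * L := by positivity
  have hy : 0 < k * L + y := by linarith
  have hdual := sum_lt_dualBound n.factorization (s := k / (k * L + y)) (by positivity)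
    n.primeFactors hS (by omega) hfac (by
      rw [div_mul_eq_mul_div, div_le_one hy]
      have : k * Real.log 74 ≤ k * L := by gcongr
      linarith)
  rw [← log_tau_eq_sum hn.ne', ← log_eq_sum, hcard, dualBound] at hdual
  have hpos : 0 < 1 + y / (k * L) := by
    have : 0 < y / (k * L) := div_pos (hkL.trans_le hlogn) hkL
    linarith
  have hinv : (k : ℝ) / (k * L + y) * L = (1 + y / (k * L))⁻¹ := by
    field_simp
  have htau : (0 : ℝ) < tau n := by
    exact_mod_cast Finset.card_pos.mpr ⟨1, Nat.one_mem_divisors.mpr hn.ne'⟩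
  rw [← Real.log_lt_log_iff htau (by positivity), Real.log_pow]
  change _ < (k : ℝ) * (k / (k * L + y) * L - 1 - Real.log (k / (k * L + y) * L)) at hdual
  rw [show k / (k * L + y) * L - 1 - Real.log (k / (k * L + y) * L) =
    k / (k * L + y) * L - 1 + Real.log (1 + y / (k * L)) by rw [hinv, Real.log_inv]; ring] at hdual
  have hcancel : (k : ℝ) * (k / (k * L + y) * L - 1) + k / (k * L + y) * y = 0 := by
    field_simp
    ring
  change Real.log (tau n) - k / (k * L + y) * y < _ at hdual
  linarith

theorem theorem4 :
    (∀ n k : ℕ, 0 < n → k = cardDistinctFactors n → 74 ≤ k →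
      (tau n : ℝ) < (1 + Real.log (n : ℝ) / ((k : ℝ) * Real.log (k : ℝ))) ^ k) ∧
    (cardDistinctFactors sharpExample = 73 ∧ 1 < lam sharpExample) :=
  ⟨fun _ _ hn hk h74 => tau_lt_pow hn hk h74,
    cardDistinctFactors_sharpExample, one_lt_lam_sharpExample⟩
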